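/- Let $(W,S)$ be a Coxeter system with length function $\ell$, and let $\omega=(\omega_1,\omega_2,\omega_3,\ldots)$ be a semi-infinite word in $S$. A (finite) subword of $\omega$ is identified with its index set: for a finite set of positions $I=\{i_1<\cdots<i_k\}$ put $\langle I\rangle=\omega_{i_1}\cdots\omega_{i_k}\in W$, and call $I$ reduced if $\ell(\langle I\rangle)=k$. Write $I\le_{\rm lex}J$ if $I=J$ or the least element of $(I\cup J)\setminus(I\cap J)$ lies in $I$. A subword $I$ is called $\omega$-sorted if it is reduced and $I\le_{\rm lex}J$ for every reduced $J$ with $\langle J\rangle=\langle I\rangle$. Let $P_\omega$ be the set of $\omega$-sorted subwords of $\omega$, ordered by inclusion of index sets (the $\omega$-sorting order). A lattice is join-distributive if for every element $x$ and every set $Y$ of elements covering $x$ such that the join $z$ of $\{x\}\cup Y$ exists, the interval $[x,z]$ is isomorphic to the lattice of all subsets of a finite set. A finite lattice is supersolvable if it has a maximal chain which together with any other maximal chain generates a distributive sublattice. Theorem. If infinitely many elements of $W$ occur as subwords of $\omega$ (so that, in particular, $W$ is infinite), then $P_\omega$ is an infinite lattice, it is locally finite (all its intervals are finite), it is join-distributive,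 and each of its intervals $[a,b]$ with $a\le b$ is a supersolvable and join-distributive lattice. -/

import Mathlib

/-! ### Lattice-theoretic notions -/

/-- A poset is boolean if it is isomorphic to the poset of all subsets of a finite set. -/
def IsBooleanOrder (P : Type*) [LE P] : Prop :=
  ∃ n : ℕ, Nonempty (P ≃o Finset (Fin n))

/-- A lattice is join-distributive if each of its atomic intervals is boolean.  The atomic
intervals are the intervals `[x, z]` for which `z` is the join of `x` and of a set `Y` of elements
covering `x` (for nonempty `Y` this is the join of `Y`; for empty `Y` the interval is `{x}`). -/
def IsJoinDistributive (P : Type*) [Lattice P] : Prop :=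
  ∀ (x z : P) (Y : Set P), (∀ y ∈ Y, x ⋖ y) → IsLUB (insert x Y) z →
    IsBooleanOrder (Set.Icc x z)

/-- The sublattice generated by `X` is distributive. -/
def GeneratesDistributive {P : Type*} [Lattice P] (X : Set P) : Prop :=
  ∀ x ∈ latticeClosure X, ∀ y ∈ latticeClosure X, ∀ z ∈ latticeClosure X,
    x ⊓ (y ⊔ z) = (x ⊓ y) ⊔ (x ⊓ z)

/-- An M-chain of a lattice: a maximal chain which together with any maximal chain generates a
distributive sublattice. -/
def IsMChain {P : Type*} [Lattice P] (m : Set P) : Prop :=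
  IsMaxChain (· ≤ ·) m ∧
    ∀ c : Set P, IsMaxChain (· ≤ ·) c → GeneratesDistributive (m ∪ c)

/-- A finite lattice is supersolvable if it has an M-chain. -/
def IsSupersolvable (P : Type*) [Lattice P] : Prop :=
  Finite P ∧ ∃ m : Set P, IsMChain m

/-! ### Sorting words in a Coxeter group -/

/-- The (finite) subword of the semi-infinite word `ω` with index set `I`. -/
def subword {B : Type*} (ω : ℕ → B) (I : Finset ℕ) : List B :=
  (I.sort (· ≤ ·)).map ω

/-- Lexicographic order on index sets: `I = J`, or the least element of the symmetric difference
of `I` and `J` is in `I`. -/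
def LexLE (I J : Finset ℕ) : Prop :=
  I = J ∨ ∃ i ∈ I, IsLeast (((I ∪ J) \ (I ∩ J) : Finset ℕ) : Set ℕ) i

section Coxeter

variable {B W : Type*} [Group W] {M : CoxeterMatrix B}

/-- The set of group elements that occur as subwords of `ω`. -/
def subwordElements (cs : CoxeterSystem M W) (ω : ℕ → B) : Set W :=
  Set.range fun I : Finset ℕ => cs.wordProd (subword ω I)

/-- The subword of `ω` with index set `I` is `ω`-sorted: it is reduced, and its index set is the
lexicographically least one among the reduced subwords of `ω` for the same group element. -/
def IsSortedSubword (cs : CoxeterSystem M W) (ω : ℕ → B) (I : Finset ℕ) : Prop :=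
  cs.IsReduced (subword ω I) ∧
    ∀ J : Finset ℕ, cs.IsReduced (subword ω J) →
      cs.wordProd (subword ω J) = cs.wordProd (subword ω I) → LexLE I J

/-- The set of `ω`-sorted subwords of `ω`; a subword is identified with its index set. -/
@[ext]
structure SortedSubword (cs : CoxeterSystem M W) (ω : ℕ → B) where
  indexSet : Finset ℕ
  isSorted : IsSortedSubword cs ω indexSet

/-- The `ω`-sorting order: inclusion of the index sets of `ω`-sorted subwords. -/
@[reducible]
def sortingOrder (cs : CoxeterSystem M W) (ω : ℕ → B) : PartialOrder (SortedSubword cs ω) where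
  le α β := α.indexSet ⊆ β.indexSet
  le_refl _ := Finset.Subset.refl _
  le_trans _ _ _ h₁ h₂ := Finset.Subset.trans h₁ h₂
  le_antisymm _ _ h₁ h₂ := SortedSubword.ext (Finset.Subset.antisymm h₁ h₂)

end Coxeter

/-! Sortedness has a local description: I is sorted iff it is greedy, meaning that at every position
p, chosen or not, `ω p` can be prefixed to the part of I after p without losing reducedness. The
exchange property turns a violation into a lexicographically smaller word (`isSortedSubword_iff`).
The decisive fact is `IsGreedySubword.insert_of_isLeast`: if I and J are greedy and x = min (J \ I),
then I ∪ {x} is greedy. It rests on an insertion lemma for reduced words,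
`CoxeterSystem.IsReduced.cons_append_cons`, which follows from strong exchange; the latter comes
from the classical action of W on W × ℤ/2.

The rest concerns set families with this extension property. Repeated insertion shows that unions of
sorted sets are sorted, so joins are unions and a meet is the largest sorted set inside the
intersection. A cover adds a single position, and single-position extensions of x can be combined
freely by unions, so atomic intervals are boolean. In [a, b], adding the positions of b to a in
increasing order gives a chain whose meets with members of the interval are plain intersections. On
the sublattice generated by it and another maximal chain, meets are then intersections throughout,
whence distributivity. -/

namespace CoxeterSystem

variable {B W : Type*} [Group W] {M : CoxeterMatrix B} (cs : CoxeterSystem M W)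

/-! ### The strong exchange property -/

section Exchange

open Classical in
/-- The action of a simple reflection on pairs of a group element and a sign. -/
noncomputable def signedConj (i : B) : Function.End (W × ZMod 2) := fun p =>
  (cs.simple i * p.1 * cs.simple i, p.2 + if p.1 = cs.simple i then 1 else 0)

open Classical in
theorem prod_map_signedConj (l : List B) (t : W) (ε : ZMod 2) :
    (l.map cs.signedConj).prod (t, ε) =
      (cs.wordProd l * t * (cs.wordProd l)⁻¹, ε + ((cs.rightInvSeq l).count t : ℕ)) := by
  induction l with
  | nil =>
    simp only [List.map_nil, List.prod_nil, wordProd_nil, one_mul, inv_one, mul_one,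
      rightInvSeq_nil, List.count_nil, Nat.cast_zero, add_zero]
    rfl
  | cons i l ih =>
    have h : ((i :: l).map cs.signedConj).prod (t, ε) =
        cs.signedConj i ((l.map cs.signedConj).prod (t, ε)) := by
      rw [List.map_cons, List.prod_cons]; rfl
    have hiff : cs.wordProd l * t * (cs.wordProd l)⁻¹ = cs.simple i ↔
        (cs.wordProd l)⁻¹ * cs.simple i * cs.wordProd l = t := by
      constructor
      · intro h; rw [← h]; group
      · intro h; rw [← h]; group
    rw [h, ih, rightInvSeq, List.count_cons]
    simp only [signedConj, hiff, beq_iff_eq, Nat.cast_add, Nat.cast_ite, Nat.cast_one,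
      Nat.cast_zero, add_assoc]
    simp only [wordProd_cons, mul_inv_rev, inv_simple, mul_assoc]

theorem alternatingWord_two_mul_add_two (i i' : B) (m : ℕ) :
    alternatingWord i i' (2 * m + 2) = i :: i' :: alternatingWord i i' (2 * m) := by
  rw [alternatingWord_succ', alternatingWord_succ']
  simp

theorem reverse_alternatingWord_two_mul (i i' : B) (m : ℕ) :
    (alternatingWord i i' (2 * m)).reverse = alternatingWord i' i (2 * m) := by
  induction m with
  | zero => rfl
  | succ m ih =>
    rw [Nat.mul_succ, alternatingWord_two_mul_add_two, List.reverse_cons, List.reverse_cons, ih]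
    simp [alternatingWord]

-- The inversion sequence of (i i')^m, with m the Coxeter exponent, runs twice through the same m
-- entries because (s s')^m = 1. For m = 0 (infinite order) the word is empty.
open Classical in
theorem even_count_rightInvSeq_alternatingWord (i i' : B) (t : W) :
    Even ((cs.rightInvSeq (alternatingWord i i' (2 * M i i'))).count t) := by
  rw [← reverse_alternatingWord_two_mul, rightInvSeq_reverse, List.count_reverse]
  set l := cs.leftInvSeq (alternatingWord i' i (2 * M i i')) with hl
  have hlen : l.length = 2 * M i i' := by simp [hl]
  have heq : l.drop (M i i') = l.take (M i i') := by
    apply List.ext_getElem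
    · simp [hlen]; lia
    · intro k h₁ h₂
      have hk : k < M i i' := by simp at h₂; lia
      simp only [List.getElem_drop, List.getElem_take, hl]
      rw [cs.getElem_leftInvSeq_alternatingWord _ _ _ _ (by lia),
        cs.getElem_leftInvSeq_alternatingWord _ _ _ _ (by lia),
        prod_alternatingWord_eq_mul_pow, prod_alternatingWord_eq_mul_pow,
        if_neg (by simp), if_neg (by simp),
        show (2 * (M i i' + k) + 1) / 2 = M i i' + k by lia,
        show (2 * k + 1) / 2 = k by lia, pow_add, simple_mul_simple_pow, one_mul]
  rw [← List.take_append_drop (M i i') l, List.count_append, heq]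
  exact ⟨_, rfl⟩

theorem isLiftable_signedConj : M.IsLiftable cs.signedConj := by
  classical
  intro i i'
  have hpow (m : ℕ) : (cs.signedConj i * cs.signedConj i') ^ m =
      ((alternatingWord i i' (2 * m)).map cs.signedConj).prod := by
    induction m with
    | zero => simp [alternatingWord]
    | succ m ih =>
      rw [pow_succ', ih, Nat.mul_succ, alternatingWord_two_mul_add_two]
      simp [mul_assoc]
  rw [hpow]
  funext ⟨t, ε⟩
  rw [prod_map_signedConj, prod_alternatingWord_eq_mul_pow]
  have h := (ZMod.natCast_eq_zero_iff_even).2 (cs.even_count_rightInvSeq_alternatingWord i i' t)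
  simp only [h, even_two, Even.mul_right, if_true, Nat.mul_div_cancel_left _ two_pos,
    simple_mul_simple_pow, one_mul, inv_one, mul_one, add_zero]
  rfl

/-- The action of the group on pairs of a group element and a sign. -/
noncomputable def signedConjHom : W →* Function.End (W × ZMod 2) :=
  cs.lift ⟨cs.signedConj, cs.isLiftable_signedConj⟩

open Classical in
theorem signedConjHom_wordProd (l : List B) (t : W) (ε : ZMod 2) :
    cs.signedConjHom (cs.wordProd l) (t, ε) =
      (cs.wordProd l * t * (cs.wordProd l)⁻¹, ε + ((cs.rightInvSeq l).count t : ℕ)) := by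
  have h : l.map (cs.signedConjHom ∘ cs.simple) = l.map cs.signedConj :=
    List.map_congr_left fun i _ => cs.lift_apply_simple cs.isLiftable_signedConj i
  rw [← prod_map_signedConj, ← h, wordProd, map_list_prod, List.map_map]

theorem exists_signedConjHom_apply (w t : W) : ∃ n : ZMod 2, ∀ ε,
    cs.signedConjHom w (t, ε) = (w * t * w⁻¹, ε + n) := by
  classical
  obtain ⟨l, rfl⟩ := cs.wordProd_surjective w
  exact ⟨_, cs.signedConjHom_wordProd l t⟩

theorem signedConjHom_mul_apply (v w : W) (p : W × ZMod 2) :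
    cs.signedConjHom (v * w) p = cs.signedConjHom v (cs.signedConjHom w p) := by
  rw [map_mul]; rfl

/-- Factor t = w s w⁻¹: the sign changes due to w⁻¹ and w cancel, since w w⁻¹ acts trivially, and s
contributes exactly 1. -/
theorem IsReflection.signedConjHom_self {t : W} (ht : cs.IsReflection t) (ε : ZMod 2) :
    cs.signedConjHom t (t, ε) = (t, ε + 1) := by
  classical
  obtain ⟨w, i, rfl⟩ := ht
  set t := w * cs.simple i * w⁻¹ with ht
  obtain ⟨n, hn⟩ := cs.exists_signedConjHom_apply w⁻¹ t
  obtain ⟨n', hn'⟩ := cs.exists_signedConjHom_apply w (cs.simple i)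
  have h₁ : w⁻¹ * t * w⁻¹⁻¹ = cs.simple i := by rw [ht]; group
  have hs (δ : ZMod 2) : cs.signedConjHom (cs.simple i) (cs.simple i, δ) =
      (cs.simple i, δ + 1) := by
    have := cs.signedConjHom_wordProd [i] (cs.simple i) δ
    simpa using this
  have h₀ : n + n' = 0 := by
    have h := cs.signedConjHom_mul_apply w w⁻¹ (t, 0)
    rw [hn, h₁, hn', mul_inv_cancel, map_one] at h
    simpa using (congrArg Prod.snd h).symm.trans (show ((t, 0) : W × ZMod 2).2 = 0 from rfl)
  rw [show cs.signedConjHom t = cs.signedConjHom (w * cs.simple i * w⁻¹) from rfl,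
    signedConjHom_mul_apply, signedConjHom_mul_apply, hn, h₁, hs, hn']
  rw [show ε + n + 1 + n' = ε + 1 + (n + n') by ring, h₀, add_zero]

/-- A right inversion of an element occurs in the right inversion sequence of every word for it. -/
theorem IsRightInversion.mem_rightInvSeq {l : List B} {t : W}
    (h : cs.IsRightInversion (cs.wordProd l) t) : t ∈ cs.rightInvSeq l := by
  classical
  by_contra hmem
  obtain ⟨ht, hlt⟩ := h
  obtain ⟨l', hl', hprod⟩ := cs.exists_isReduced (cs.wordProd l * t)
  -- Were t missing from the sequence of `l`, the action of wt would flip the sign at t, so t would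
  -- be an inversion of wt, making w = (wt)t shorter than wt.
  have h₁ := cs.signedConjHom_mul_apply (cs.wordProd l) t (t, 0)
  rw [ht.signedConjHom_self, signedConjHom_wordProd, hprod, signedConjHom_wordProd,
    List.count_eq_zero.2 hmem] at h₁
  have h₂ : t ∈ cs.rightInvSeq l' := by
    by_contra hmem'
    rw [List.count_eq_zero.2 hmem'] at h₁
    simpa using congrArg Prod.snd h₁
  have h₃ := (cs.isRightInversion_of_mem_rightInvSeq hl' h₂).2
  rw [← hprod, mul_assoc, ht.mul_self, mul_one] at h₃
  exact lt_asymm h₃ hlt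

/-- The strong exchange property. -/
theorem exists_eraseIdx_of_length_mul_lt {l : List B} {t : W} (ht : cs.IsReflection t)
    (h : cs.length (t * cs.wordProd l) < cs.length (cs.wordProd l)) :
    ∃ j < l.length, t * cs.wordProd l = cs.wordProd (l.eraseIdx j) := by
  have h₁ : cs.IsRightInversion (cs.wordProd l.reverse) t := by
    rw [wordProd_reverse, isRightInversion_inv_iff]; exact ⟨ht, h⟩
  have h₂ : t ∈ cs.leftInvSeq l := by
    simpa [rightInvSeq_reverse] using h₁.mem_rightInvSeq
  obtain ⟨j, hj, rfl⟩ := List.mem_iff_getElem.mp h₂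
  refine ⟨j, by simpa using hj, ?_⟩
  rw [← getD_leftInvSeq_mul_wordProd, List.getD_eq_getElem _ _ hj]

end Exchange

/-! ### Reduced words -/

section Reduced

variable {cs}

theorem IsReduced.of_append_left {l l' : List B} (h : cs.IsReduced (l ++ l')) :
    cs.IsReduced l := by
  simpa using h.take l.length

theorem IsReduced.of_append_right {l l' : List B} (h : cs.IsReduced (l ++ l')) :
    cs.IsReduced l' := by
  simpa using h.drop l.length

theorem IsReduced.of_cons {i : B} {l : List B} (h : cs.IsReduced (i :: l)) :
    cs.IsReduced l := by
  simpa using h.drop 1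

theorem isReduced_nil : cs.IsReduced [] := by simp [IsReduced]

theorem IsReduced.cons_iff {i : B} {l : List B} (h : cs.IsReduced l) :
    cs.IsReduced (i :: l) ↔ ¬ cs.IsLeftDescent (cs.wordProd l) i := by
  rw [not_isLeftDescent_iff, IsReduced, wordProd_cons, h.eq, List.length_cons]

theorem exists_eraseIdx_of_isLeftDescent {l : List B} {i : B}
    (h : cs.IsLeftDescent (cs.wordProd l) i) :
    ∃ j < l.length, cs.simple i * cs.wordProd l = cs.wordProd (l.eraseIdx j) :=
  cs.exists_eraseIdx_of_length_mul_lt (cs.isReflection_simple i) h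

theorem length_wordProd_eraseIdx_lt {l : List B} {j : ℕ} (hj : j < l.length) :
    cs.length (cs.wordProd (l.eraseIdx j)) < l.length := by
  have h₁ := cs.length_wordProd_le (l.eraseIdx j)
  have h₂ := List.length_eraseIdx_add_one hj
  lia

/-- If a letter can be inserted into a reduced word so that both the part from its second letter
on and the part up to the new letter are reduced, then the whole word is reduced. -/
theorem IsReduced.cons_append_cons {r s : B} {u v : List B} (huv : cs.IsReduced (r :: (u ++ v)))
    (husv : cs.IsReduced (u ++ s :: v)) (hrus : cs.IsReduced (r :: (u ++ [s]))) :
    cs.IsReduced (r :: (u ++ s :: v)) := by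
  induction v using List.reverseRecOn with
  | nil => exact hrus
  | append_singleton v q ih =>
    have eq₁ : u ++ s :: (v ++ [q]) = (u ++ s :: v) ++ [q] := by simp
    have eq₂ : r :: (u ++ (v ++ [q])) = (r :: (u ++ v)) ++ [q] := by simp
    rw [eq₁] at husv ⊢
    have ih' := ih ((eq₂ ▸ huv).of_append_left) husv.of_append_left
    by_contra hnot
    have hdesc := (not_iff_not.2 husv.cons_iff).1 hnot
    rw [not_not] at hdesc
    set x := cs.wordProd (u ++ s :: v) with hx
    have hlx : cs.length x = (u ++ s :: v).length := husv.of_append_left.eq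
    have hrx : cs.length (cs.simple r * x) = (u ++ s :: v).length + 1 := by
      rw [hx, ← wordProd_cons, ih'.eq, List.length_cons]
    -- Exchange deletes a letter from the word for xq. Deleting one inside x would make rx too
    -- short, so the deleted letter is q.
    have hxq : cs.simple r * x = x * cs.simple q := by
      obtain ⟨j, hj, hjeq⟩ := exists_eraseIdx_of_isLeftDescent hdesc
      rw [List.length_append, List.length_singleton] at hj
      rcases Nat.lt_or_ge j (u ++ s :: v).length with hlt | hge
      · rw [List.eraseIdx_append_of_lt_length hlt, wordProd_append _ _ [q],
          wordProd_append _ _ [q], ← mul_assoc, mul_left_inj, ← hx] at hjeq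
        have := length_wordProd_eraseIdx_lt (cs := cs) hlt
        rw [← hjeq, hrx] at this
        lia
      · obtain rfl : j = (u ++ s :: v).length := by lia
        rw [List.eraseIdx_append_of_length_le le_rfl] at hjeq
        simp only [Nat.sub_self, List.eraseIdx_cons_zero, List.append_nil, wordProd_append _ _ [q],
          wordProd_singleton, ← hx] at hjeq
        rw [← simple_mul_simple_cancel_left cs (w := x * cs.simple q) r, hjeq]
    -- Left multiplication by t deletes the inserted letter s. It shortens rx = xq, so strong
    -- exchange applies to the reduced word for rx.
    set t := cs.wordProd u * cs.simple s * (cs.wordProd u)⁻¹ with ht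
    have htx : t * (x * cs.simple q) = cs.wordProd (u ++ (v ++ [q])) := by
      simp only [ht, hx, wordProd_append, wordProd_cons]
      simp [mul_assoc]
    have hrt : cs.length (cs.simple r * (t * (x * cs.simple q))) = (u ++ s :: v).length + 1 := by
      rw [htx, ← wordProd_cons, huv.eq]; simp
    have hlt : cs.length (t * cs.wordProd (r :: (u ++ s :: v))) <
        cs.length (cs.wordProd (r :: (u ++ s :: v))) := by
      rw [ih'.eq, wordProd_cons, ← hx, hxq, htx, huv.of_cons.eq]
      simp
    obtain ⟨j, hj, hjeq⟩ := cs.exists_eraseIdx_of_length_mul_lt ⟨_, _, ht⟩ hlt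
    rw [wordProd_cons, ← hx] at hjeq
    -- Deleting r forces t = r, so r u s = u, against `hrus`. Deleting a later letter makes r u v q
    -- too short, against `huv`.
    cases j with
    | zero =>
      rw [List.eraseIdx_cons_zero, ← hx] at hjeq
      have htr : t * cs.simple r = 1 := by
        rwa [← mul_assoc, mul_eq_right] at hjeq
      have h₁ : cs.simple r * cs.wordProd u * cs.simple s = cs.wordProd u := by
        have htr' : cs.simple r = t := by
          rw [eq_comm, ← cs.inv_simple r]; exact eq_inv_of_mul_eq_one_left htr
        rw [htr', ht]; simp [mul_assoc]
      have h₂ := hrus.eq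
      rw [wordProd_cons, wordProd_append, wordProd_singleton, ← mul_assoc, h₁] at h₂
      have h₃ := cs.length_wordProd_le u
      simp at h₂
      lia
    | succ j =>
      rw [hxq, List.eraseIdx_cons_succ, wordProd_cons] at hjeq
      rw [hjeq, simple_mul_simple_cancel_left] at hrt
      have := length_wordProd_eraseIdx_lt (cs := cs) (l := u ++ s :: v) (j := j)
        (by simpa using hj)
      lia

end Reduced

end CoxeterSystem

/-! ### Words of index sets -/

section Subword

variable {B : Type*} (ω : ℕ → B)

theorem subword_empty : subword ω ∅ = [] := by simp [subword]

theorem subword_singleton (p : ℕ) : subword ω {p} = [ω p] := by simp [subword]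

theorem subword_insert {p : ℕ} {I : Finset ℕ} (h : ∀ i ∈ I, p < i) :
    subword ω (insert p I) = ω p :: subword ω I := by
  rw [subword, Finset.sort_insert _ (fun i hi => (h i hi).le) (fun hp => lt_irrefl _ (h p hp)),
    List.map_cons, subword]

theorem subword_union {I J : Finset ℕ} (h : ∀ i ∈ I, ∀ j ∈ J, i < j) :
    subword ω (I ∪ J) = subword ω I ++ subword ω J := by
  induction I using Finset.induction_on_min with
  | empty => simp [subword_empty]
  | insert p I hp ih =>
    have hJ := ih fun i hi => h i (Finset.mem_insert_of_mem hi)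
    rw [Finset.insert_union, subword_insert ω hp, subword_insert, hJ, List.cons_append]
    intro i hi
    rcases Finset.mem_union.1 hi with hi | hi
    exacts [hp i hi, h p (Finset.mem_insert_self _ _) i hi]

theorem exists_subword_eraseIdx (I : Finset ℕ) (j : ℕ) :
    ∃ K ⊆ I, subword ω K = (subword ω I).eraseIdx j := by
  have hsub := List.eraseIdx_sublist (I.sort (· ≤ ·)) j
  refine ⟨((I.sort (· ≤ ·)).eraseIdx j).toFinset, ?_, ?_⟩
  · intro i hi
    simpa using hsub.subset (List.mem_toFinset.1 hi)
  · rw [subword, (List.toFinset_sort _ (hsub.nodup (Finset.sort_nodup _ _))).2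
      ((Finset.pairwise_sort I (· ≤ ·)).sublist hsub), subword, List.eraseIdx_map]

theorem subword_eq_append_of_mem {p : ℕ} {I : Finset ℕ} (hp : p ∈ I) :
    subword ω I =
      subword ω (I.filter (· < p)) ++ ω p :: subword ω (I.filter (p < ·)) := by
  have h : I = I.filter (· < p) ∪ insert p (I.filter (p < ·)) := by
    ext i
    rcases lt_trichotomy i p with hi | rfl | hi
    · simp [hi, hi.ne, hi.le]
    · simp [hp]
    · simp [hi, hi.ne', hi.le]
  conv_lhs => rw [h]
  rw [subword_union, subword_insert]
  · intro i hi; exact (Finset.mem_filter.1 hi).2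
  · intro i hi j hj
    have hi := (Finset.mem_filter.1 hi).2
    rcases Finset.mem_insert.1 hj with rfl | hj
    exacts [hi, hi.trans (Finset.mem_filter.1 hj).2]

theorem subword_eq_append_of_notMem {p : ℕ} {I : Finset ℕ} (hp : p ∉ I) :
    subword ω I = subword ω (I.filter (· < p)) ++ subword ω (I.filter (p < ·)) := by
  have h : I = I.filter (· < p) ∪ I.filter (p < ·) := by
    ext i
    rcases lt_trichotomy i p with hi | rfl | hi
    · simp [hi, hi.le]
    · simp [hp]
    · simp [hi, hi.le]
  conv_lhs => rw [h]
  rw [subword_union]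
  intro i hi j hj
  exact (Finset.mem_filter.1 hi).2.trans (Finset.mem_filter.1 hj).2

end Subword

/-! ### Sorted subwords are the greedy subwords -/

section Sorted

variable {B W : Type*} [Group W] {M : CoxeterMatrix B} {cs : CoxeterSystem M W} {ω : ℕ → B}

/-- At every position `p`, the letter `ω p` may be prepended to the part of the subword `I` after
`p` without losing reducedness. -/
def IsGreedySubword (cs : CoxeterSystem M W) (ω : ℕ → B) (I : Finset ℕ) : Prop :=
  ∀ p, cs.IsReduced (ω p :: subword ω (I.filter (p < ·)))

theorem isReduced_subword_filter_gt {I : Finset ℕ} {p : ℕ}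
    (h : ∀ q, p < q → cs.IsReduced (ω q :: subword ω (I.filter (q < ·)))) :
    cs.IsReduced (subword ω (I.filter (p < ·))) := by
  rcases (I.filter (p < ·)).eq_empty_or_nonempty with hI | hI
  · rw [hI, subword_empty]; exact CoxeterSystem.isReduced_nil
  · set q := (I.filter (p < ·)).min' hI with hq
    have hmem := Finset.min'_mem _ hI
    rw [← hq, Finset.mem_filter] at hmem
    have heq : I.filter (p < ·) = insert q (I.filter (q < ·)) := by
      ext i
      simp only [Finset.mem_filter, Finset.mem_insert]
      constructor
      · intro hi
        have := Finset.min'_le _ i (Finset.mem_filter.2 hi)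
        rw [← hq] at this
        rcases this.eq_or_lt with h' | h'
        exacts [Or.inl h'.symm, Or.inr ⟨hi.1, h'⟩]
      · rintro (rfl | hi)
        exacts [hmem, ⟨hi.1, hmem.2.trans hi.2⟩]
    rw [heq, subword_insert ω fun i hi => (Finset.mem_filter.1 hi).2]
    exact h q hmem.2

namespace IsGreedySubword

theorem isReduced {I : Finset ℕ} (h : IsGreedySubword cs ω I) :
    cs.IsReduced (subword ω I) := by
  by_cases h0 : 0 ∈ I
  · have hlt : I.filter (· < 0) = ∅ := by simp
    rw [subword_eq_append_of_mem ω h0, hlt, subword_empty]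
    exact h 0
  · have heq : I.filter (0 < ·) = I := Finset.filter_true_of_mem fun i hi =>
      Nat.pos_of_ne_zero fun hi0 => h0 (hi0 ▸ hi)
    have := (h 0).of_cons
    rwa [heq] at this

theorem filter_lt {I : Finset ℕ} (h : IsGreedySubword cs ω I) (x : ℕ) :
    IsGreedySubword cs ω (I.filter (· < x)) := by
  intro p
  have heq : I.filter (p < ·) = (I.filter (· < x)).filter (p < ·) ∪
      (I.filter (p < ·)).filter (x ≤ ·) := by
    ext i
    rcases lt_or_ge i x with hi | hi
    · simp [hi, hi.not_ge]
    · simp [hi, hi.not_gt]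
  have hp := h p
  rw [heq, subword_union, ← List.cons_append] at hp
  · exact hp.of_append_left
  · intro i hi j hj
    simp only [Finset.mem_filter] at hi hj
    exact hi.1.2.trans_le hj.2

/-- Greediness after inserting x need only be tested on the part of I below x. Going down through
positions p < x, the insertion lemma applies with r = `ω p`, s = `ω x`, and u, v the letters of I
between p and x and after x. -/
theorem insert_of_insert_filter {I : Finset ℕ} (h : IsGreedySubword cs ω I) {x : ℕ} (hx : x ∉ I)
    (h' : IsGreedySubword cs ω (insert x (I.filter (· < x)))) :
    IsGreedySubword cs ω (insert x I) := by
  have key : ∀ d p, x ≤ p + d →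
      cs.IsReduced (ω p :: subword ω ((insert x I).filter (p < ·))) := by
    intro d
    induction d with
    | zero =>
      intro p hp
      rw [Finset.filter_insert, if_neg (by lia)]
      exact h p
    | succ d ih =>
      intro p hp
      rcases Nat.lt_or_ge p x with hpx | hpx
      · have hred := isReduced_subword_filter_gt (cs := cs) (ω := ω) (I := insert x I) (p := p)
          fun q hq => ih q (by lia)
        have hmem : x ∈ (insert x I).filter (p < ·) :=
          Finset.mem_filter.2 ⟨Finset.mem_insert_self _ _, hpx⟩
        have hgt : ((insert x I).filter (p < ·)).filter (x < ·) = I.filter (x < ·) := by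
          ext i; simp only [Finset.mem_filter, Finset.mem_insert]; grind
        have hlt : ((insert x I).filter (p < ·)).filter (· < x) =
            (I.filter (p < ·)).filter (· < x) := by
          ext i; simp only [Finset.mem_filter, Finset.mem_insert]; grind
        have hgt' : (I.filter (p < ·)).filter (x < ·) = I.filter (x < ·) := by
          ext i; simp only [Finset.mem_filter]; grind
        rw [subword_eq_append_of_mem ω hmem, hgt, hlt] at hred ⊢
        refine CoxeterSystem.IsReduced.cons_append_cons ?_ hred ?_
        · have := h p
          rwa [subword_eq_append_of_notMem ω (p := x) (by simp [hx]), hgt'] at this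
        · have := h' p
          have heq : (insert x (I.filter (· < x))).filter (p < ·) =
              (I.filter (p < ·)).filter (· < x) ∪ {x} := by
            ext i
            simp only [Finset.mem_filter, Finset.mem_insert, Finset.mem_union,
              Finset.mem_singleton]
            grind
          rwa [heq, subword_union, subword_singleton] at this
          intro i hi j hj
          rw [Finset.mem_singleton.1 hj]
          exact (Finset.mem_filter.1 hi).2
      · exact ih p (by lia)
  exact fun p => key x p (by lia)

/-- Two greedy subwords `I` and `J` yield the greedy subword `I ∪ {min (J \ I)}`. -/
theorem insert_of_isLeast {I J : Finset ℕ} {x : ℕ} (hI : IsGreedySubword cs ω I)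
    (hJ : IsGreedySubword cs ω J) (hx : IsLeast ((J : Set ℕ) \ I) x) :
    IsGreedySubword cs ω (insert x I) := by
  induction x using Nat.strong_induction_on generalizing I J with
  | _ x ih =>
    refine hI.insert_of_insert_filter hx.1.2 ?_
    -- Start with K the part of J below x: it lies in I by minimality, and K ∪ {x} is an initial
    -- part of J. The missing elements of I below x are added in increasing order; each is smaller
    -- than x, so the induction hypothesis covers it.
    have key : ∀ n K, K ⊆ I.filter (· < x) → (I.filter (· < x) \ K).card = n →
        IsGreedySubword cs ω (insert x K) →
        IsGreedySubword cs ω (insert x (I.filter (· < x))) := by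
      intro n
      induction n with
      | zero =>
        intro K hK hcard hg
        rw [Finset.card_eq_zero, Finset.sdiff_eq_empty_iff_subset] at hcard
        rwa [Finset.Subset.antisymm hK hcard] at hg
      | succ n ihn =>
        intro K hK hcard hg
        have hne : (I.filter (· < x) \ K).Nonempty := by
          rw [← Finset.card_pos]; lia
        have hy := Finset.min'_mem _ hne
        have hymin := Finset.min'_le (I.filter (· < x) \ K)
        set y := (I.filter (· < x) \ K).min' hne
        have hyx : y < x := (Finset.mem_filter.1 (Finset.mem_sdiff.1 hy).1).2
        have hg' : IsGreedySubword cs ω (insert y (insert x K)) := by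
          refine ih y hyx hg (hI.filter_lt x) ⟨⟨(Finset.mem_sdiff.1 hy).1, ?_⟩, ?_⟩
          · simpa [hyx.ne] using (Finset.mem_sdiff.1 hy).2
          · rintro i ⟨hi, hi'⟩
            refine hymin i (Finset.mem_sdiff.2 ⟨hi, fun hiK => hi' ?_⟩)
            exact Finset.mem_insert_of_mem hiK
        rw [Finset.insert_comm] at hg'
        refine ihn (insert y K) ?_ ?_ hg'
        · exact Finset.insert_subset (Finset.mem_sdiff.1 hy).1 hK
        · rw [Finset.sdiff_insert, Finset.card_erase_of_mem hy, hcard, Nat.add_sub_cancel]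
    refine key _ (J.filter (· < x)) ?_ rfl ?_
    · intro i hi
      rw [Finset.mem_filter] at hi ⊢
      refine ⟨?_, hi.2⟩
      by_contra hiI
      exact absurd (hx.2 ⟨hi.1, hiI⟩) (not_le.2 hi.2)
    · have heq : insert x (J.filter (· < x)) = J.filter (· < x + 1) := by
        have := hx.1.1
        rw [SetLike.mem_coe] at this
        ext i; simp only [Finset.mem_filter, Finset.mem_insert]; grind
      rw [heq]
      exact hJ.filter_lt _

end IsGreedySubword

/-- If an unused position p violated greediness, exchange would trade a letter after p for p itself,
giving a reduced word for the same element that is lexicographically smaller. -/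
theorem IsSortedSubword.isGreedySubword {I : Finset ℕ} (h : IsSortedSubword cs ω I) :
    IsGreedySubword cs ω I := by
  intro p
  by_cases hp : p ∈ I
  · have := h.1
    rw [subword_eq_append_of_mem ω hp] at this
    exact this.of_append_right
  · have hsplit := subword_eq_append_of_notMem ω hp
    have hred : cs.IsReduced (subword ω (I.filter (p < ·))) := by
      have := h.1
      rw [hsplit] at this
      exact this.of_append_right
    rw [hred.cons_iff]
    intro hdesc
    obtain ⟨j, hj, hjeq⟩ := CoxeterSystem.exists_eraseIdx_of_isLeftDescent hdesc
    obtain ⟨K, hK, hKeq⟩ := exists_subword_eraseIdx ω (I.filter (p < ·)) j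
    have hKp : ∀ i ∈ K, p < i := fun i hi => (Finset.mem_filter.1 (hK hi)).2
    rw [← hKeq] at hjeq
    set J := I.filter (· < p) ∪ insert p K with hJ
    have hJw : subword ω J = subword ω (I.filter (· < p)) ++ ω p :: subword ω K := by
      rw [hJ, subword_union, subword_insert ω hKp]
      intro i hi k hk
      have hi := (Finset.mem_filter.1 hi).2
      rcases Finset.mem_insert.1 hk with rfl | hk
      exacts [hi, hi.trans (hKp k hk)]
    have hprod : cs.wordProd (subword ω J) = cs.wordProd (subword ω I) := by
      rw [hJw, hsplit, cs.wordProd_append, cs.wordProd_append, cs.wordProd_cons, ← hjeq,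
        cs.simple_mul_simple_cancel_left]
    have hJred : cs.IsReduced (subword ω J) := by
      have hlen := List.length_eraseIdx_add_one hj
      have hI := h.1.eq
      rw [CoxeterSystem.IsReduced, hprod, hI, hJw, hsplit, List.length_append, List.length_append,
        List.length_cons, hKeq, hlen]
    have hpJ : p ∈ J := Finset.mem_union_right _ (Finset.mem_insert_self _ _)
    rcases h.2 J hJred hprod with heq | ⟨i, hi, hleast⟩
    · exact hp (heq ▸ hpJ)
    · have hip : i ≤ p := hleast.2 (by simp [hp, hpJ])
      have hip' : i < p := lt_of_le_of_ne hip fun h => hp (h ▸ hi)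
      have hiJ : i ∈ J := Finset.mem_union_left _ (Finset.mem_filter.2 ⟨hi, hip'⟩)
      have := hleast.1
      simp [hi, hiJ] at this

/-- Suppose the first difference i lay in J. After cancelling the common prefix, `ω i` would be a
left descent of the tail of I, contrary to greediness at i. -/
theorem IsGreedySubword.isSortedSubword {I : Finset ℕ} (h : IsGreedySubword cs ω I) :
    IsSortedSubword cs ω I := by
  refine ⟨h.isReduced, fun J hJ hprod => ?_⟩
  by_cases hIJ : I = J
  · exact Or.inl hIJ
  right
  have hne : ((I ∪ J) \ (I ∩ J)).Nonempty := by
    rw [Finset.nonempty_iff_ne_empty, Ne, Finset.sdiff_eq_empty_iff_subset]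
    intro hsub
    exact hIJ (Finset.Subset.antisymm
      (Finset.subset_union_left.trans (hsub.trans Finset.inter_subset_right))
      (Finset.subset_union_right.trans (hsub.trans Finset.inter_subset_left)))
  have hleast := Finset.isLeast_min' _ hne
  set i := ((I ∪ J) \ (I ∩ J)).min' hne
  refine ⟨i, ?_, hleast⟩
  by_contra hiI
  have hiJ : i ∈ J := by
    have := hleast.1
    simp only [SetLike.mem_coe, Finset.mem_sdiff, Finset.mem_union] at this
    exact this.1.resolve_left hiI
  have hlt : I.filter (· < i) = J.filter (· < i) := by
    ext k
    simp only [Finset.mem_filter, and_congr_left_iff]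
    intro hk
    by_contra hne
    have hk' : k ∈ (I ∪ J) \ (I ∩ J) := by
      simp only [Finset.mem_sdiff, Finset.mem_union, Finset.mem_inter]
      tauto
    exact absurd (hleast.2 hk') (not_le.2 hk)
  have hi := h i
  rw [subword_eq_append_of_mem ω hiJ] at hJ hprod
  rw [subword_eq_append_of_notMem ω hiI, hlt, cs.wordProd_append, cs.wordProd_append,
    mul_right_inj] at hprod
  have h₁ := hi.eq
  have h₂ := hJ.of_append_right.eq
  have h₃ := hi.of_cons.eq
  have h₄ := cs.length_wordProd_le (subword ω (J.filter (i < ·)))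
  rw [cs.wordProd_cons, ← hprod, cs.wordProd_cons, cs.simple_mul_simple_cancel_left,
    List.length_cons] at h₁
  rw [hprod, h₃, List.length_cons] at h₂
  lia

theorem isSortedSubword_iff {I : Finset ℕ} :
    IsSortedSubword cs ω I ↔ IsGreedySubword cs ω I :=
  ⟨IsSortedSubword.isGreedySubword, IsGreedySubword.isSortedSubword⟩

theorem isGreedySubword_empty : IsGreedySubword cs ω ∅ := by
  intro p
  simp [subword_empty, CoxeterSystem.IsReduced]

/-- The window [p, p + d) is processed one position at a time. Exchange replaces the tail after p by
a subset K whose product does not have `ω p` as a left descent; K is made greedy recursively, and p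
is used exactly when the product still needs it. -/
theorem exists_greedy_from (d p : ℕ) (J : Finset ℕ) (hJ : ∀ i ∈ J, p ≤ i ∧ i < p + d) :
    ∃ I : Finset ℕ, (∀ i ∈ I, p ≤ i) ∧
      cs.wordProd (subword ω I) = cs.wordProd (subword ω J) ∧
      ∀ q, p ≤ q → cs.IsReduced (ω q :: subword ω (I.filter (q < ·))) := by
  induction d generalizing p J with
  | zero =>
    obtain rfl : J = ∅ := Finset.eq_empty_of_forall_notMem fun i hi => by
      have := hJ i hi; lia
    exact ⟨∅, by simp, rfl, fun q _ => isGreedySubword_empty q⟩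
  | succ d ih =>
    have hJ₁ : cs.wordProd (subword ω (J.filter (p < ·))) = cs.wordProd (subword ω J) ∨
        cs.simple (ω p) * cs.wordProd (subword ω (J.filter (p < ·))) =
          cs.wordProd (subword ω J) := by
      have hlt : J.filter (· < p) = ∅ :=
        Finset.filter_false_of_mem fun i hi => not_lt.2 (hJ i hi).1
      by_cases hp : p ∈ J
      · right
        rw [subword_eq_append_of_mem ω hp, hlt, subword_empty, List.nil_append,
          cs.wordProd_cons]
      · left
        rw [subword_eq_append_of_notMem ω hp, hlt, subword_empty, List.nil_append]
    obtain ⟨K, hK, hKprod, hKdesc⟩ : ∃ K ⊆ J.filter (p < ·),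
        (cs.wordProd (subword ω K) = cs.wordProd (subword ω J) ∨
          cs.simple (ω p) * cs.wordProd (subword ω K) = cs.wordProd (subword ω J)) ∧
        ¬ cs.IsLeftDescent (cs.wordProd (subword ω K)) (ω p) := by
      by_cases hdesc : cs.IsLeftDescent (cs.wordProd (subword ω (J.filter (p < ·)))) (ω p)
      · obtain ⟨j, -, hj⟩ := CoxeterSystem.exists_eraseIdx_of_isLeftDescent hdesc
        obtain ⟨K, hK, hKeq⟩ := exists_subword_eraseIdx ω (J.filter (p < ·)) j
        rw [← hKeq] at hj
        refine ⟨K, hK, ?_, ?_⟩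
        · rw [← hj, cs.simple_mul_simple_cancel_left]
          exact hJ₁.symm
        · rw [← hj]
          exact cs.isLeftDescent_iff_not_isLeftDescent_mul.1 hdesc
      · exact ⟨_, subset_rfl, hJ₁, hdesc⟩
    obtain ⟨I, hIp, hIprod, hI⟩ := ih (p + 1) K fun i hi => by
      have h₁ := Finset.mem_filter.1 (hK hi)
      have h₂ := hJ i h₁.1
      lia
    have hIgt : I.filter (p < ·) = I := Finset.filter_true_of_mem hIp
    have hred : cs.IsReduced (ω p :: subword ω I) := by
      have h₁ := isReduced_subword_filter_gt (cs := cs) (ω := ω) (I := I) (p := p) hI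
      rw [hIgt] at h₁
      rwa [h₁.cons_iff, hIprod]
    have hIq : ∀ q, p ≤ q → cs.IsReduced (ω q :: subword ω (I.filter (q < ·))) := by
      intro q hq
      rcases hq.eq_or_lt with rfl | hq
      · rwa [hIgt]
      · exact hI q hq
    rcases hKprod with hKprod | hKprod
    · exact ⟨I, fun i hi => (Nat.lt_of_succ_le (hIp i hi)).le, hIprod.trans hKprod, hIq⟩
    · refine ⟨insert p I, ?_, ?_, fun q hq => ?_⟩
      · intro i hi
        rcases Finset.mem_insert.1 hi with rfl | hi
        exacts [le_rfl, (Nat.lt_of_succ_le (hIp i hi)).le]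
      · rw [subword_insert ω hIp, cs.wordProd_cons, hIprod, hKprod]
      · rw [Finset.filter_insert, if_neg (not_lt.2 hq)]
        exact hIq q hq

/-- Every group element that occurs as a subword has a sorted subword. -/
theorem exists_isSortedSubword (cs : CoxeterSystem M W) (ω : ℕ → B) (J : Finset ℕ) :
    ∃ I, IsSortedSubword cs ω I ∧
      cs.wordProd (subword ω I) = cs.wordProd (subword ω J) := by
  obtain ⟨n, hn⟩ := J.bddAbove
  obtain ⟨I, -, hprod, hI⟩ := exists_greedy_from (cs := cs) (ω := ω) (n + 1) 0 J fun i hi => by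
    have := hn hi
    exact ⟨Nat.zero_le i, by lia⟩
  exact ⟨I, isSortedSubword_iff.2 fun p => hI p (Nat.zero_le p), hprod⟩

theorem infinite_sortedSubword (hω : (subwordElements cs ω).Infinite) :
    Infinite (SortedSubword cs ω) := by
  by_contra hfin
  rw [not_infinite_iff_finite] at hfin
  refine hω ((Set.finite_range fun I : SortedSubword cs ω =>
    cs.wordProd (subword ω I.indexSet)).subset ?_)
  rintro _ ⟨J, rfl⟩
  obtain ⟨I, hI, hprod⟩ := exists_isSortedSubword cs ω J
  exact ⟨⟨I, hI⟩, hprod⟩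

end Sorted

/-! ### Lattices of finite sets of natural numbers with a minimal extension property -/

/-- An embedding of a lattice into the finite sets of natural numbers that takes joins to unions,
and whose range contains, with any `A` and `B`, the set `A ∪ {min (B \ A)}`. -/
structure IsSetRepresentation {P : Type*} [Lattice P] (φ : P → Finset ℕ) : Prop where
  le_iff : ∀ a b, a ≤ b ↔ φ a ⊆ φ b
  map_sup : ∀ a b, φ (a ⊔ b) = φ a ∪ φ b
  exists_insert : ∀ a b x, IsLeast ((φ b : Set ℕ) \ φ a) x → ∃ c, φ c = insert x (φ a)

namespace IsSetRepresentation

variable {P : Type*} [Lattice P] {φ : P → Finset ℕ}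

theorem injective (h : IsSetRepresentation φ) : Function.Injective φ := fun a b hab =>
  le_antisymm ((h.le_iff a b).2 hab.le) ((h.le_iff b a).2 hab.ge)

theorem exists_isLeast (h : IsSetRepresentation φ) {a b : P} (hab : ¬ b ≤ a) :
    ∃ x, IsLeast ((φ b : Set ℕ) \ φ a) x := by
  rw [h.le_iff, Finset.not_subset] at hab
  obtain ⟨x, hx⟩ := hab
  exact ⟨_, isLeast_csInf (s := (φ b : Set ℕ) \ φ a) ⟨x, hx⟩⟩

theorem exists_eq_insert_of_covBy (h : IsSetRepresentation φ) {x y : P} (hxy : x ⋖ y) :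
    ∃ t, φ y = insert t (φ x) := by
  obtain ⟨t, ht⟩ := h.exists_isLeast hxy.lt.not_ge
  obtain ⟨c, hc⟩ := h.exists_insert _ _ _ ht
  have hxc : x < c := by
    rw [lt_iff_le_not_ge, h.le_iff, h.le_iff, hc]
    exact ⟨Finset.subset_insert _ _, fun hsub => ht.1.2 (hsub (Finset.mem_insert_self _ _))⟩
  have hcy : c ≤ y := by
    rw [h.le_iff, hc, Finset.insert_subset_iff]
    exact ⟨ht.1.1, (h.le_iff _ _).1 hxy.le⟩
  exact ⟨t, by rw [← hc, (hcy.eq_of_not_lt (hxy.2 hxc))]⟩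

theorem exists_eq_union (h : IsSetRepresentation φ) {x : P} {E : Finset ℕ}
    (hE : ∀ t ∈ E, ∃ y, φ y = insert t (φ x)) : ∃ y, φ y = φ x ∪ E := by
  induction E using Finset.induction_on with
  | empty => exact ⟨x, by simp⟩
  | insert t E _ ih =>
    obtain ⟨y, hy⟩ := ih fun s hs => hE s (Finset.mem_insert_of_mem hs)
    obtain ⟨z, hz⟩ := hE t (Finset.mem_insert_self _ _)
    refine ⟨y ⊔ z, ?_⟩
    rw [h.map_sup, hy, hz]
    ext; simp; tauto

theorem isJoinDistributive (h : IsSetRepresentation φ) : IsJoinDistributive P := by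
  classical
  intro x z Y hY hz
  have hxz : x ≤ z := hz.1 (Set.mem_insert _ _)
  -- The union of the one-point extensions coming from `Y` is represented by an upper bound `z'` of
  -- x and `Y`, so z ≤ `z'` and each point of z outside x is one of those extensions.
  have hins : ∀ t ∈ φ z \ φ x, ∃ y, φ y = insert t (φ x) := by
    obtain ⟨z', hz'⟩ := h.exists_eq_union (x := x)
      (E := (φ z).filter fun t => ∃ y ∈ Y, φ y = insert t (φ x))
      fun t ht => (Finset.mem_filter.1 ht).2.imp fun _ hy => hy.2
    have hle : z ≤ z' := hz.2 <| by
      rintro y (rfl | hy)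
      · rw [h.le_iff, hz']; exact Finset.subset_union_left
      · obtain ⟨t, ht⟩ := h.exists_eq_insert_of_covBy (hY y hy)
        have hyz := (h.le_iff _ _).1 (hz.1 (Set.mem_insert_of_mem _ hy))
        rw [h.le_iff, hz', ht, Finset.insert_subset_iff]
        refine ⟨Finset.mem_union_right _ (Finset.mem_filter.2 ⟨hyz ?_, y, hy, ht⟩),
          Finset.subset_union_left⟩
        rw [ht]; exact Finset.mem_insert_self _ _
    intro t ht
    rw [Finset.mem_sdiff] at ht
    have := (h.le_iff _ _).1 hle ht.1
    rw [hz', Finset.mem_union] at this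
    exact ((Finset.mem_filter.1 (this.resolve_left ht.2)).2).imp fun _ hy => hy.2
  let g := (φ z \ φ x).equivFin.symm
  let f : Set.Icc x z ↪o Finset (Fin (φ z \ φ x).card) :=
    OrderEmbedding.ofMapLEIff (fun e => Finset.univ.filter fun i => (g i : ℕ) ∈ φ e.1) <| by
      intro a b
      rw [← Subtype.coe_le_coe, h.le_iff]
      constructor
      · intro hab s hs
        by_cases hsx : s ∈ φ x
        · exact (h.le_iff _ _).1 b.2.1 hsx
        · have hsz : s ∈ φ z \ φ x := Finset.mem_sdiff.2 ⟨(h.le_iff _ _).1 a.2.2 hs, hsx⟩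
          have := @hab (g.symm ⟨s, hsz⟩) (by simpa using hs)
          simpa using this
      · intro hab i hi
        simp only [Finset.mem_filter, Finset.mem_univ, true_and] at hi ⊢
        exact hab hi
  refine ⟨(φ z \ φ x).card, ⟨RelIso.ofSurjective f ?_⟩⟩
  intro T
  obtain ⟨y, hy⟩ := h.exists_eq_union (x := x) (E := T.image fun i => (g i : ℕ)) <| by
    intro t ht
    obtain ⟨i, _, rfl⟩ := Finset.mem_image.1 ht
    exact hins _ (g i).2
  refine ⟨⟨y, ?_, ?_⟩, ?_⟩
  · rw [h.le_iff, hy]; exact Finset.subset_union_left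
  · rw [h.le_iff, hy]
    refine Finset.union_subset ((h.le_iff _ _).1 hxz) fun t ht => ?_
    obtain ⟨i, _, rfl⟩ := Finset.mem_image.1 ht
    exact (Finset.mem_sdiff.1 (g i).2).1
  · ext i
    have hi := (Finset.mem_sdiff.1 (g i).2).2
    simp [f, hy, hi]

/-- The points of c missing from a can be adjoined in increasing order, since each is the least one
still missing. -/
theorem exists_eq_union_filter (h : IsSetRepresentation φ) (a c : P) (k : ℕ) :
    ∃ e, φ e = φ a ∪ (φ c).filter (· < k) := by
  induction k with
  | zero => exact ⟨a, by simp⟩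
  | succ k ih =>
    obtain ⟨e, he⟩ := ih
    by_cases hk : k ∈ φ c ∧ k ∉ φ a
    · obtain ⟨d, hd⟩ := h.exists_insert e c k <| by
        refine ⟨⟨hk.1, by simp [he, hk.2]⟩, ?_⟩
        rintro s ⟨hs, hs'⟩
        by_contra! hsk
        simp only [SetLike.mem_coe] at hs
        simp [he, hs, hsk] at hs'
      refine ⟨d, ?_⟩
      rw [hd, he]
      ext s
      simp only [Finset.mem_insert, Finset.mem_union, Finset.mem_filter, Nat.lt_succ_iff_lt_or_eq]
      constructor
      · rintro (rfl | hs | hs)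
        exacts [Or.inr ⟨hk.1, Or.inr rfl⟩, Or.inl hs, Or.inr ⟨hs.1, Or.inl hs.2⟩]
      · rintro (hs | ⟨hs, hs' | rfl⟩)
        exacts [Or.inr (Or.inl hs), Or.inr (Or.inr ⟨hs, hs'⟩), Or.inl rfl]
    · refine ⟨e, ?_⟩
      rw [he]
      ext s
      simp only [Finset.mem_union, Finset.mem_filter, Nat.lt_succ_iff_lt_or_eq]
      constructor
      · rintro (hs | hs)
        exacts [Or.inl hs, Or.inr ⟨hs.1, Or.inl hs.2⟩]
      · rintro (hs | ⟨hs, hs' | rfl⟩)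
        · exact Or.inl hs
        · exact Or.inr ⟨hs, hs'⟩
        · exact Or.inl (by by_contra hs'; exact hk ⟨hs, hs'⟩)

/-- The intersection is a together with the points of c below k, which is itself represented and
hence lies below the meet. -/
theorem map_inf_of_initial (h : IsSetRepresentation φ) {a b m c : P} {k : ℕ} (hac : a ≤ c)
    (hcb : c ≤ b) (hm : φ m = φ a ∪ (φ b).filter (· < k)) : φ (m ⊓ c) = φ m ∩ φ c := by
  apply le_antisymm
  · exact Finset.subset_inter ((h.le_iff _ _).1 inf_le_left) ((h.le_iff _ _).1 inf_le_right)
  · obtain ⟨e, he⟩ := h.exists_eq_union_filter a c k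
    have hac' := (h.le_iff _ _).1 hac
    have hcb' := (h.le_iff _ _).1 hcb
    have hem : e ≤ m := by
      rw [h.le_iff, he, hm]
      exact Finset.union_subset_union_right (Finset.filter_subset_filter _ hcb')
    have hec : e ≤ c := by
      rw [h.le_iff, he]
      exact Finset.union_subset hac' (Finset.filter_subset _ _)
    refine le_trans ?_ ((h.le_iff _ _).1 (le_inf hem hec))
    intro s hs
    simp only [hm, he, Finset.mem_inter, Finset.mem_union, Finset.mem_filter] at hs ⊢
    tauto

theorem _root_.IsMaxChain.mem_of_forall_le {P : Type*} [PartialOrder P] {c : Set P}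
    (hc : IsMaxChain (· ≤ ·) c) {t : P} (ht : ∀ x, x ≤ t) : t ∈ c := by
  have := hc.2 (hc.1.insert fun b _ _ => Or.inr (ht b)) (Set.subset_insert t c)
  rw [this]; exact Set.mem_insert _ _

theorem isMaxChain_initial (h : IsSetRepresentation φ) {bt tp : P} (hb : ∀ x, bt ≤ x)
    (ht : ∀ x, x ≤ tp) :
    IsMaxChain (· ≤ ·) {m | ∃ k, φ m = φ bt ∪ (φ tp).filter (· < k)} := by
  constructor
  · rintro m ⟨k, hk⟩ m' ⟨k', hk'⟩ _
    rcases le_total k k' with hle | hle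
    · left
      show m ≤ m'
      rw [h.le_iff, hk, hk']
      exact Finset.union_subset_union_right
        (Finset.monotone_filter_right _ fun s _ hs => lt_of_lt_of_le hs hle)
    · right
      show m' ≤ m
      rw [h.le_iff, hk, hk']
      exact Finset.union_subset_union_right
        (Finset.monotone_filter_right _ fun s _ hs => lt_of_lt_of_le hs hle)
  · intro C hC hsub
    refine Set.Subset.antisymm hsub fun e he => ?_
    have hbe := (h.le_iff _ _).1 (hb e)
    have hte := (h.le_iff _ _).1 (ht e)
    by_cases hle : tp ≤ e
    · obtain rfl := le_antisymm hle (ht e)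
      obtain ⟨k, hk⟩ := (φ tp).bddAbove
      refine ⟨k + 1, ?_⟩
      rw [Finset.filter_true_of_mem fun s hs => Nat.lt_succ_of_le (hk hs)]
      exact (Finset.union_eq_right.2 hbe).symm
    -- With x the least point missing from e, the chain member cut at x + 1 contains x, so it must
    -- lie above e. This pins e down as the member cut at x.
    · obtain ⟨x, hx⟩ := h.exists_isLeast hle
      obtain ⟨m, hm⟩ := h.exists_eq_union_filter bt tp (x + 1)
      have hme : ¬ m ≤ e := fun hme => hx.1.2 <| (h.le_iff _ _).1 hme <| by
        rw [hm]; exact Finset.mem_union_right _ (Finset.mem_filter.2 ⟨hx.1.1, Nat.lt_succ_self x⟩)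
      have hem : e ≤ m := (hC.total he (hsub ⟨x + 1, hm⟩)).resolve_right hme
      refine ⟨x, Finset.Subset.antisymm (fun s hs => ?_) (Finset.union_subset hbe fun s hs => ?_)⟩
      · have hs' := (h.le_iff _ _).1 hem hs
        rw [hm] at hs'
        simp only [Finset.mem_union, Finset.mem_filter, Nat.lt_succ_iff_lt_or_eq] at hs' ⊢
        rcases hs' with hs' | ⟨hs₁, hs₂ | rfl⟩
        · exact Or.inl hs'
        · exact Or.inr ⟨hs₁, hs₂⟩
        · exact absurd hs hx.1.2
      · rw [Finset.mem_filter] at hs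
        by_contra hse
        exact absurd (hx.2 ⟨hs.1, hse⟩) (not_le.2 hs.2)

theorem generatesDistributive (h : IsSetRepresentation φ) {m c : Set P} {tp : P}
    (hm : IsMaxChain (· ≤ ·) m) (hc : IsMaxChain (· ≤ ·) c) (ht : ∀ x, x ≤ tp)
    (hinf : ∀ x ∈ m, ∀ y ∈ c, φ (x ⊓ y) = φ x ∩ φ y) : GeneratesDistributive (m ∪ c) := by
  -- Elements that are unions of meets x ⊓ y of the two chains. Meets within a chain stay in it, so
  -- `S` is a sublattice on which meets are intersections; the top, lying in both chains, puts the
  -- chains inside `S`.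
  let S : Set P := {e | ∀ i ∈ φ e, ∃ x ∈ m, ∃ y ∈ c, i ∈ φ (x ⊓ y) ∧ x ⊓ y ≤ e}
  have htm := hm.mem_of_forall_le ht
  have htc := hc.mem_of_forall_le ht
  have hchain {C : Set P} (hC : IsMaxChain (· ≤ ·) C) {x x' : P} (hx : x ∈ C) (hx' : x' ∈ C)
      {i : ℕ} (hi : i ∈ φ x) (hi' : i ∈ φ x') : x ⊓ x' ∈ C ∧ i ∈ φ (x ⊓ x') := by
    rcases hC.1.total hx hx' with hle | hle
    · rw [inf_eq_left.2 hle]; exact ⟨hx, hi⟩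
    · rw [inf_eq_right.2 hle]; exact ⟨hx', hi'⟩
  have hSinf : ∀ e ∈ S, ∀ f ∈ S, φ (e ⊓ f) = φ e ∩ φ f ∧ e ⊓ f ∈ S := by
    intro e he f hf
    have key : ∀ i ∈ φ e ∩ φ f, ∃ x ∈ m, ∃ y ∈ c, i ∈ φ (x ⊓ y) ∧ x ⊓ y ≤ e ⊓ f := by
      intro i hi
      rw [Finset.mem_inter] at hi
      obtain ⟨x, hx, y, hy, hixy, hle⟩ := he i hi.1
      obtain ⟨x', hx', y', hy', hixy', hle'⟩ := hf i hi.2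
      rw [hinf _ hx _ hy, Finset.mem_inter] at hixy
      rw [hinf _ hx' _ hy', Finset.mem_inter] at hixy'
      obtain ⟨hxm, hix⟩ := hchain hm hx hx' hixy.1 hixy'.1
      obtain ⟨hyc, hiy⟩ := hchain hc hy hy' hixy.2 hixy'.2
      refine ⟨_, hxm, _, hyc, ?_, le_inf ?_ ?_⟩
      · rw [hinf _ hxm _ hyc]; exact Finset.mem_inter.2 ⟨hix, hiy⟩
      · exact (inf_le_inf inf_le_left inf_le_left).trans hle
      · exact (inf_le_inf inf_le_right inf_le_right).trans hle'
    have heq : φ (e ⊓ f) = φ e ∩ φ f := by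
      refine Finset.Subset.antisymm (Finset.subset_inter ((h.le_iff _ _).1 inf_le_left)
        ((h.le_iff _ _).1 inf_le_right)) fun i hi => ?_
      obtain ⟨x, _, y, _, hixy, hle⟩ := key i hi
      exact (h.le_iff _ _).1 hle hixy
    exact ⟨heq, fun i hi => key i (heq ▸ hi)⟩
  have hSsup : ∀ e ∈ S, ∀ f ∈ S, e ⊔ f ∈ S := by
    intro e he f hf i hi
    rw [h.map_sup, Finset.mem_union] at hi
    rcases hi with hi | hi
    · obtain ⟨x, hx, y, hy, hixy, hle⟩ := he i hi
      exact ⟨x, hx, y, hy, hixy, hle.trans le_sup_left⟩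
    · obtain ⟨x, hx, y, hy, hixy, hle⟩ := hf i hi
      exact ⟨x, hx, y, hy, hixy, hle.trans le_sup_right⟩
  have hsub : latticeClosure (m ∪ c) ⊆ S := by
    refine latticeClosure_min ?_
      ⟨fun e he f hf => hSsup e he f hf, fun e he f hf => (hSinf e he f hf).2⟩
    rintro e (he | he) i hi
    · exact ⟨e, he, tp, htc, by rwa [inf_eq_left.2 (ht e)], inf_le_left⟩
    · exact ⟨tp, htm, e, he, by rwa [inf_eq_right.2 (ht e)], inf_le_right⟩
  intro x hx y hy z hz
  have hx := hsub hx
  have hy := hsub hy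
  have hz := hsub hz
  apply h.injective
  rw [(hSinf _ hx _ (hSsup _ hy _ hz)).1, h.map_sup, h.map_sup, (hSinf _ hx _ hy).1,
    (hSinf _ hx _ hz).1, Finset.inter_union_distrib_left]

theorem isSupersolvable (h : IsSetRepresentation φ) {bt tp : P} (hb : ∀ x, bt ≤ x)
    (ht : ∀ x, x ≤ tp) : IsSupersolvable P := by
  refine ⟨?_, _, h.isMaxChain_initial hb ht, fun c hc => ?_⟩
  · refine Finite.of_injective
      (fun x => (⟨φ x, Finset.mem_powerset.2 ((h.le_iff _ _).1 (ht x))⟩ : (φ tp).powerset)) ?_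
    intro x y hxy
    exact h.injective (congrArg Subtype.val hxy)
  · refine h.generatesDistributive (h.isMaxChain_initial hb ht) hc ht ?_
    rintro x ⟨k, hk⟩ y _
    exact h.map_inf_of_initial (hb y) (ht y) hk

theorem restrict_Icc (h : IsSetRepresentation φ) (a b : P) :
    IsSetRepresentation fun x : Set.Icc a b => φ x.1 where
  le_iff x y := h.le_iff x.1 y.1
  map_sup x y := h.map_sup x.1 y.1
  exists_insert x y s hs := by
    obtain ⟨c, hc⟩ := h.exists_insert x.1 y.1 s hs
    refine ⟨⟨c, ?_, ?_⟩, hc⟩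
    · rw [h.le_iff, hc]
      exact ((h.le_iff _ _).1 x.2.1).trans (Finset.subset_insert _ _)
    · rw [h.le_iff, hc, Finset.insert_subset_iff]
      exact ⟨(h.le_iff _ _).1 y.2.2 hs.1.1, (h.le_iff _ _).1 x.2.2⟩

theorem isSupersolvable_Icc (h : IsSetRepresentation φ) {a b : P} (hab : a ≤ b) :
    IsSupersolvable (Set.Icc a b) :=
  (h.restrict_Icc a b).isSupersolvable (bt := ⟨a, le_rfl, hab⟩) (tp := ⟨b, hab, le_rfl⟩)
    (fun x => x.2.1) fun x => x.2.2

end IsSetRepresentation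

/-! ### The lattice of sorted subwords -/

section SortingLattice

variable {B W : Type*} [Group W] {M : CoxeterMatrix B} {cs : CoxeterSystem M W} {ω : ℕ → B}

theorem isSortedSubword_empty : IsSortedSubword cs ω ∅ :=
  isSortedSubword_iff.2 isGreedySubword_empty

theorem IsSortedSubword.insert_of_isLeast {I J : Finset ℕ} {x : ℕ} (hI : IsSortedSubword cs ω I)
    (hJ : IsSortedSubword cs ω J) (hx : IsLeast ((J : Set ℕ) \ I) x) :
    IsSortedSubword cs ω (insert x I) := by
  rw [isSortedSubword_iff] at *
  exact hI.insert_of_isLeast hJ hx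

/-- The elements of J \ I are inserted into I one at a time, always the least remaining one. -/
theorem IsSortedSubword.union {I J : Finset ℕ} (hI : IsSortedSubword cs ω I)
    (hJ : IsSortedSubword cs ω J) : IsSortedSubword cs ω (I ∪ J) := by
  induction hn : (J \ I).card generalizing I with
  | zero =>
    rw [Finset.card_eq_zero, Finset.sdiff_eq_empty_iff_subset] at hn
    rwa [Finset.union_eq_left.2 hn]
  | succ n ih =>
    have hne : (J \ I).Nonempty := by rw [← Finset.card_pos]; lia
    have hleast := Finset.isLeast_min' _ hne
    set x := (J \ I).min' hne
    rw [Finset.coe_sdiff] at hleast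
    have hxJ : x ∈ J := hleast.1.1
    have := ih (hI.insert_of_isLeast hJ hleast) <| by
      rw [Finset.sdiff_insert, Finset.card_erase_of_mem (Finset.min'_mem _ hne), hn,
        Nat.add_sub_cancel]
    rwa [Finset.insert_union, Finset.insert_eq_of_mem (Finset.mem_union_right _ hxJ)] at this

open Classical in
/-- The union of all sorted subwords contained in a given set of positions. -/
noncomputable def sortedInterior (cs : CoxeterSystem M W) (ω : ℕ → B) (I : Finset ℕ) :
    Finset ℕ :=
  (I.powerset.filter (IsSortedSubword cs ω)).sup id

theorem isSortedSubword_sortedInterior (I : Finset ℕ) :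
    IsSortedSubword cs ω (sortedInterior cs ω I) := by
  classical
  exact Finset.sup_induction isSortedSubword_empty (fun _ h _ h' => h.union h')
    fun _ h => (Finset.mem_filter.1 h).2

theorem sortedInterior_subset (I : Finset ℕ) : sortedInterior cs ω I ⊆ I := by
  classical
  exact Finset.sup_le fun _ h => Finset.mem_powerset.1 (Finset.mem_filter.1 h).1

theorem IsSortedSubword.subset_sortedInterior {I J : Finset ℕ} (hJ : IsSortedSubword cs ω J)
    (h : J ⊆ I) : J ⊆ sortedInterior cs ω I := by
  classical
  exact Finset.le_sup (f := id) (Finset.mem_filter.2 ⟨Finset.mem_powerset.2 h, hJ⟩)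

/-- The sorting order is a lattice, in which joins are unions. -/
@[reducible]
noncomputable def sortingLattice (cs : CoxeterSystem M W) (ω : ℕ → B) :
    Lattice (SortedSubword cs ω) where
  __ := sortingOrder cs ω
  sup α β := ⟨α.indexSet ∪ β.indexSet, α.isSorted.union β.isSorted⟩
  le_sup_left _ _ := Finset.subset_union_left
  le_sup_right _ _ := Finset.subset_union_right
  sup_le _ _ _ h h' := Finset.union_subset h h'
  inf α β := ⟨sortedInterior cs ω (α.indexSet ∩ β.indexSet), isSortedSubword_sortedInterior _⟩
  inf_le_left _ _ := (sortedInterior_subset _).trans Finset.inter_subset_left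
  inf_le_right _ _ := (sortedInterior_subset _).trans Finset.inter_subset_right
  le_inf γ _ _ h h' := γ.isSorted.subset_sortedInterior (Finset.subset_inter h h')

theorem isSetRepresentation_indexSet (cs : CoxeterSystem M W) (ω : ℕ → B) :
    letI := sortingLattice cs ω
    IsSetRepresentation (SortedSubword.indexSet : SortedSubword cs ω → Finset ℕ) :=
  letI := sortingLattice cs ω
  { le_iff := fun _ _ => Iff.rfl
    map_sup := fun _ _ => rfl
    exists_insert := fun a b _ hx => ⟨⟨_, a.isSorted.insert_of_isLeast b.isSorted hx⟩, rfl⟩ }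

end SortingLattice

theorem mainTheorem6 {B W : Type*} [Group W] {M : CoxeterMatrix B} (cs : CoxeterSystem M W)
    (ω : ℕ → B) (hω : (subwordElements cs ω).Infinite) :
    Infinite (SortedSubword cs ω) ∧
    ∃ L : Lattice (SortedSubword cs ω),
      L.toPartialOrder = sortingOrder cs ω ∧
      (∀ a b : SortedSubword cs ω, (Set.Icc a b).Finite) ∧
      IsJoinDistributive (SortedSubword cs ω) ∧
      ∀ a b : SortedSubword cs ω, a ≤ b →
        IsSupersolvable (Set.Icc a b) ∧ IsJoinDistributive (Set.Icc a b) := by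
  let := sortingLattice cs ω
  have h := isSetRepresentation_indexSet cs ω
  refine ⟨infinite_sortedSubword hω, sortingLattice cs ω, rfl, fun a b => ?_,
    h.isJoinDistributive, fun a b hab => ⟨h.isSupersolvable_Icc hab,
      (h.restrict_Icc a b).isJoinDistributive⟩⟩
  exact (b.indexSet.powerset.finite_toSet.preimage (h.injective.injOn)).subset fun x hx =>
    Finset.mem_coe.2 (Finset.mem_powerset.2 hx.2)
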